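/- **Setting.** There are $n$ agents, $N=\{0,\dots,n-1\}$, in a synchronous system with reliable channels and rounds $1,2,\dots$, each with a send, a receive and an update phase. Agent $i$ has an initial preference $v_i\in V$ ($V$ an arbitrary set, e.g. $\{0,1\}$). A failure pattern $F$ is a set of failures $(i,m,A)$ of distinct agents: $i$ crashes in round $m\ge 1$, in round $m$ its messages go out only to the agents in $A\subseteq N$ ($A\ne\emptyset$ if $m>1$), and it does not complete round $m$ or take part in later rounds. Agents that do not fail in $F$ are *correct* (nonfaulty). A context is a pair $(F,\vec v)$. Let $f+1<n$, let $p\ge n$ be a prime, and let $a_0,\dots,a_{n-1}\in\mathbb F_p$ be distinct (e.g. $a_j=j$). **The protocol $\sigma^{\rm cons}$.** *Coins* (all independent and uniform). Agent $i$ draws $z$ and, for each round $m$ and $j\neq i$, $z_{ij}^m[i]$ from $\{0,\dots,n-1\}$; for $0\le t\le f$ it draws $x_i[t]\in\{0,\dots,n-t-1\}$ and a polynomial $q_i^t\in\mathbb F_p[X]$ of degree at most $1$, uniform subject to $q_i^t(0)=x_i[t]$. The share of $l$ is $y_{il}^t=q_i^t(a_l)$. Initially $z_{ij}^1[j]=z$,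 $z_{ij}^1[l]=0$ for $l\ne i,j$, and the status report is $SR_i^1[j]=(\infty,\bot)$ for all $j$. *Send.* In each round $m\le f+1$ in which it has not yet decided, $i$ sends to each $j\ne i$: its status report $SR_i^m$; if $m=1$, also $v_i$ and $(y_{ij}^t)_{t\le f}$; if $m=1$ or $m\le f$, also $z_{ij}^m$; if $m=f+1$, also all shares $(y_{li}^t)_{t\le f}$, $l\ne j$, that it holds, including its own $y_{ii}^t$. *Receive.* Start with $SR_i^{m+1}=SR_i^m$ and process the agents $j\ne i$ in turn. If a message from $j$ arrives, set $SR_i^{m+1}[j]=(\infty,z_{ji}^m)$ (with $\bot$ in place of $z_{ji}^m$ if no such vector was sent), and for each $l\ne i,j$ for which $SR_j^m[l]$ gives a smaller crash round $m'$ than $SR_i^m[l]$, set $SR_i^{m+1}[l]=(m',j)$. If no message from $j$ arrives and $SR_i^{m+1}[j]=(\infty,\cdot)$, set $SR_i^{m+1}[j]=(m,i)$. The entry $z_{il}^{m+1}[j]$, $l\ne i,j$, is $z_{ji}^m[j]$ if $j$ reports $l$ as not crashed, and $\bot$ otherwise; $z_{ij}^{m+1}[j]=\bot$. Preferences and shares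 received are stored. *Update.* If $i$ detects an inconsistency in round $m\le f+1$, i.e. its preference, its coins and the messages it has received so far do not occur in any run in which all agents follow the protocol except that at most $f$ agents crash ($i$ not having crashed by round $m$), then $i$ decides $\bot$ and stops. Otherwise, at the end of round $f+1$, $i$ sets $NC_0=N$ and, for $1\le m\le f+1$, $NC_m=\{i\}\cup\{j: SR_i^{f+2}[j]\text{ does not give a crash round}\le m\}$. Round $m\in\{1,\dots,f+1\}$ *seems clean* to $i$ if $NC_m=NC_{m-1}$. Let $m^*$ be the first round that seems clean and $t=n-|NC_{m^*}|$. For $j\in NC_{m^*}$, $i$ obtains $x_j[t]$ as the value at $0$ of the unique polynomial of degree at most $1$ through the shares of $q_j^t$ that it knows, computes $S=\sum_{j\in NC_{m^*}}x_j[t]\bmod (n-t)$, and decides $v_j$, where $j$, the *dictator*, is the agent with the $(S+1)$st highest identifier in $NC_{m^*}$. **Theorem.** Suppose at most $f$ agents crash and all agents otherwise follow $\sigma^{\rm cons}$. Then $\sigma^{\rm cons}$ solves fair consensus; that is, in each context $(F,\vec v)$ with at most $f$ failures, every run satisfies * Agreement: no two correct agents decide different values; * Termination: every correct agent eventually decides;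 * Integrity: every agent decides at most once; * Validity: if an agent decides $d$, then $d$ is the initial preference of some agent (in particular $d\ne\bot$); and over the coin tosses it satisfies * Fairness: for all $v\in V$, if $c$ correct agents have initial preference $v$, then with probability at least $c/n$ all correct agents decide $v$. Moreover, for each such context there are a round $m^*$ and a set $K\subseteq N$ containing all correct agents such that: 1. for all coin tosses and every correct agent $i$, $m^*$ is the first round that seems clean to $i$, and $NC_{m^*}=K$ as computed by $i$; 2. for all coin tosses, every correct agent $i$, all $j\in K$ and all $0\le t\le f$, $q_j^t$ is the only polynomial of degree at most $1$ through the shares $y_{jl}^t$ known to $i$ at the end of round $f+1$ (for $j=i$, $i$ knows all of them); 3. for all coin tosses, all correct agents select the same dictator, it is in $K$, and they all decide its initial preference; 4. each $j\in K$ is the dictator with probability exactly $1/|K|\ge 1/n$. -/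

import Mathlib

open Polynomial

namespace FairConsensus

noncomputable section

open scoped Classical

/-! ### Failures, contexts and the consensus properties -/

/-- A failure pattern: a set of failures `(i, m, A)` of distinct agents.  `fail i = some (m, A)`
means that agent `i` crashes in round `m` (rounds are numbered from `1`) and that in this round its
messages go out to the agents in `A` only; `fail i = none` means that `i` is nonfaulty. -/
structure FailurePattern (n : ℕ) where
  fail : Fin n → Option (ℕ × Finset (Fin n))
  round_pos : ∀ i m A, fail i = some (m, A) → 1 ≤ m
  nonempty_of_one_lt : ∀ i m A, fail i = some (m, A) → 1 < m → A.Nonempty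

namespace FailurePattern

variable {n : ℕ}

/-- The agents that never crash. -/
def Correct (F : FailurePattern n) (i : Fin n) : Prop := F.fail i = none

def faulty (F : FailurePattern n) : Finset (Fin n) := Finset.univ.filter fun i => ¬ F.Correct i

/-- According to `F`, the message that agent `i` is supposed to send to `j` in round `m` is sent. -/
def Sends (F : FailurePattern n) (i : Fin n) (m : ℕ) (j : Fin n) : Prop :=
  ∀ c A, F.fail i = some (c, A) → m < c ∨ (m = c ∧ j ∈ A)

/-- Agent `i` has not crashed in round `m` or earlier, so it completes round `m`. -/
def Survives (F : FailurePattern n) (i : Fin n) (m : ℕ) : Prop :=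
  ∀ c A, F.fail i = some (c, A) → m < c

end FailurePattern

/-- What an agent decides: `some v` is the decision `v`, and `none` is the decision `⊥`. -/
abbrev Decision (V : Type*) := Option V

/-- The decisions made in a run: `D i m = some d` if agent `i` decides `d` in round `m`, and
`D i m = none` if `i` makes no decision in round `m`. -/
abbrev Outcome (n : ℕ) (V : Type*) := Fin n → ℕ → Option (Decision V)

section Properties

variable {n : ℕ} {V : Type*}

/-- No two correct agents decide different values. -/
def Agreement (F : FailurePattern n) (D : Outcome n V) : Prop :=
  ∀ i j, F.Correct i → F.Correct j → ∀ m m' d d', D i m = some d → D j m' = some d' → d = d'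

/-- Every correct agent eventually decides. -/
def Termination (F : FailurePattern n) (D : Outcome n V) : Prop :=
  ∀ i, F.Correct i → ∃ m d, D i m = some d

/-- All agents decide at most once. -/
def Integrity (D : Outcome n V) : Prop :=
  ∀ i m m' d d', D i m = some d → D i m' = some d' → m = m'

/-- Whatever an agent decides is the initial preference of some agent (in particular, not `⊥`). -/
def Validity (v : Fin n → V) (D : Outcome n V) : Prop :=
  ∀ i m d, D i m = some d → ∃ j, d = some (v j)

/-- `u` is the consensus decision: every correct agent decides `u`. -/
def IsConsensus (F : FailurePattern n) (D : Outcome n V) (u : V) : Prop :=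
  ∀ i, F.Correct i → ∃ m, D i m = some (some u)

/-- Probability of an event under the uniform distribution on a finite sample space. -/
def prob {Ω : Type*} [Finite Ω] (E : Set Ω) : ℝ := (Nat.card E : ℝ) / (Nat.card Ω : ℝ)

/-- If `c` of the nonfaulty agents have initial preference `u`, then `u` is the consensus decision
with probability at least `c / n`. -/
def Fairness {Ω : Type*} [Finite Ω] (F : FailurePattern n) (v : Fin n → V)
    (D : Ω → Outcome n V) : Prop :=
  ∀ u : V, ((Finset.univ.filter fun i => F.Correct i ∧ v i = u).card : ℝ) / (n : ℝ)
    ≤ prob {ω | IsConsensus F (D ω) u}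

/-- A randomized protocol, given by the decisions made in each context for each outcome `ω` of the
agents' coin tosses, solves fair consensus if at most `f` agents crash. -/
def SolvesFairConsensus {Ω : Type*} [Finite Ω] (f : ℕ)
    (D : FailurePattern n → (Fin n → V) → Ω → Outcome n V) : Prop :=
  ∀ F : FailurePattern n, F.faulty.card ≤ f → ∀ v : Fin n → V,
    (∀ ω, Agreement F (D F v ω) ∧ Termination F (D F v ω) ∧ Integrity (D F v ω) ∧
      Validity v (D F v ω)) ∧
    Fairness F v (D F v)

end Properties

/-! ### Messages, coin tosses and local states of the protocol -/

/-- A vector of signature numbers, indexed by agents; `none` is the entry `⊥`. -/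
abbrev ZVec (n : ℕ) := Fin n → Option ℕ

/-- An entry of a status report: `active z` is `(∞, z)`, where `z` is the vector last received from
the agent, or `⊥`; `crashed m j` is `(m, j)`: the agent crashed in round `m`, as reported by `j`. -/
inductive Status (n : ℕ) where
  | active (z : Option (ZVec n))
  | crashed (m : ℕ) (j : Fin n)

/-- The first component of an entry of a status report. -/
def Status.time {n : ℕ} : Status n → ℕ∞
  | .active _ => ⊤
  | .crashed m _ => (m : ℕ∞)

/-- The shares of one agent's `f + 1` secrets that belong to one agent. -/
abbrev Shares (f p : ℕ) := Fin (f + 1) → ZMod p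

/-- A message; a component that is not sent in the given round is `none`.  In round `f + 1`,
`reveal = some g`, where `g l` is the tuple of shares of the secrets of `l` that the sender holds
(`g l = none` if it does not hold or does not send them). -/
structure Message (n f p : ℕ) (V : Type*) where
  pref : Option V
  status : Fin n → Status n
  shares : Option (Shares f p)
  z : Option (ZVec n)
  reveal : Option (Fin n → Option (Shares f p))

/-- The messages that an agent receives in a round, tagged by the sender. -/
abbrev Inbox (n f p : ℕ) (V : Type*) := Fin n → Option (Message n f p V)

/-- All coin tosses of one agent `i`, in this order: the number `z`; the numbers `z_{ij}^m[i]`, for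
`m = 1, …, f + 1` (shifted by one) and every `j`; the secrets `x_i[t]` in `{0, …, n - t - 1}`, for
`t = 0, …, f`; and the slopes of the polynomials `q_i^t`.  They are independent and uniform. -/
abbrev Tape (n f p : ℕ) :=
  Fin n × (Fin (f + 1) → Fin n → Fin n) × ((t : Fin (f + 1)) → Fin (n - t)) ×
    (Fin (f + 1) → ZMod p)

/-- The coin tosses of all agents. -/
abbrev Coins (n f p : ℕ) := Fin n → Tape n f p

section Protocol

variable {n f p : ℕ} {V : Type*}

def Tape.common (τ : Tape n f p) : ℕ := (τ.1 : ℕ)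

/-- The random number `z_{ij}^m[i]`, for `1 ≤ m ≤ f + 1`. -/
def Tape.sig (τ : Tape n f p) (m : ℕ) (j : Fin n) : ℕ := (τ.2.1 (Fin.ofNat (f + 1) (m - 1)) j : ℕ)

/-- The secret `x_i[t]`. -/
def Tape.secret (τ : Tape n f p) (t : Fin (f + 1)) : ℕ := (τ.2.2.1 t : ℕ)

/-- The polynomial `q_i^t`, random subject to `q_i^t(0) = x_i[t]` and `deg q_i^t ≤ 1`. -/
def Tape.poly (τ : Tape n f p) (t : Fin (f + 1)) : (ZMod p)[X] :=
  C (τ.2.2.2 t) * X + C (τ.secret t : ZMod p)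

/-- The shares `(q_i^0(a), …, q_i^f(a))` at the point `a`. -/
def Tape.sharesAt (τ : Tape n f p) (a : ZMod p) : Shares f p := fun t => (τ.poly t).eval a

/-- The local state of an agent `i` between two rounds. -/
structure LocalState (n f p : ℕ) (V : Type*) where
  /-- The set `ST_i` of pairs `(j, v_j)`, as a partial function. -/
  st : Fin n → Option V
  /-- The status report to be sent next. -/
  status : Fin n → Status n
  /-- `z j` is the vector to be sent to `j` next. -/
  z : Fin n → ZVec n
  /-- `held l` is the tuple of shares `y_{li}^0, …, y_{li}^f` that `i` holds. -/
  held : Fin n → Option (Shares f p)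
  /-- `revealed j l` is the tuple of shares `y_{jl}^0, …, y_{jl}^f` that `l` sent to `i`. -/
  revealed : Fin n → Fin n → Option (Shares f p)
  /-- The messages received so far, latest round first. -/
  hist : List (Inbox n f p V)
  /-- Whether `i` has decided. -/
  decided : Bool
  /-- The decision made in the last round, if any. -/
  out : Option (Decision V)

/-- The initial state of agent `i`.  Here `pt j` is the point of evaluation for the shares of agent
`j`; agent `i` also holds its own share of its own secrets. -/
def initState (pt : Fin n → ZMod p) (i : Fin n) (v : V) (τ : Tape n f p) : LocalState n f p V where
  st := fun j => if j = i then some v else none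
  status := fun _ => .active none
  z := fun j l => if l = i then some (τ.sig 1 j) else if l = j then some τ.common else some 0
  held := fun l => if l = i then some (τ.sharesAt (pt i)) else none
  revealed := fun _ _ => none
  hist := []
  decided := false
  out := none

/-- Send phase: the message of an agent to `j` in round `m`; `v` is its initial preference. -/
def message (pt : Fin n → ZMod p) (v : V) (τ : Tape n f p) (s : LocalState n f p V)
    (m : ℕ) (j : Fin n) : Message n f p V where
  pref := if m = 1 then some v else none
  status := s.status
  shares := if m = 1 then some (τ.sharesAt (pt j)) else none
  z := if m = 1 ∨ m ≤ f then some (s.z j) else none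
  reveal := if m = f + 1 then some (fun l => if l = j then none else s.held l) else none

/-- One pass, for the sender `j`, through the loop of the receive phase of agent `i` in round `m`:
its effect on the entry for agent `l` of the new status report, whose value before the pass is `e`;
`old` is the status report sent in round `m`. -/
def statusStep (i : Fin n) (m : ℕ) (old : Fin n → Status n) (I : Inbox n f p V) (l : Fin n)
    (e : Status n) (j : Fin n) : Status n :=
  match I j with
  | some msg =>
    if l = j then .active msg.z
    else match msg.status l with
      | .crashed m' _ => if (m' : ℕ∞) < (old l).time then .crashed m' j else e
      | .active _ => e
  | none =>
    if l = j then
      match e with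
      | .active _ => .crashed m i
      | .crashed m' k => .crashed m' k
    else e

/-- The new status report of agent `i`; the loop runs through all `j ≠ i` in increasing order. -/
def newStatus (i : Fin n) (m : ℕ) (old : Fin n → Status n) (I : Inbox n f p V) :
    Fin n → Status n :=
  fun l => if l = i then old l
    else ((List.finRange n).filter (fun j => j ≠ i)).foldl (statusStep i m old I l) (old l)

/-- The vector to be sent to `l` in the next round: its entry for `j ≠ i` is the number
`z_{ji}^m[j]` just received from `j` if `j` reports that `l` is active, and `⊥` otherwise. -/
def newZ (i : Fin n) (m : ℕ) (τ : Tape n f p) (I : Inbox n f p V) : Fin n → ZVec n :=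
  fun l j =>
    if j = i then some (τ.sig (m + 1) l)
    else (I j).bind fun msg =>
      if l = j then none
      else match msg.status l with
        | .active _ => msg.z.bind fun z => z j
        | .crashed _ _ => none

/-- Receive phase of agent `i` in round `m`. -/
def receive (i : Fin n) (m : ℕ) (τ : Tape n f p) (I : Inbox n f p V) (s : LocalState n f p V) :
    LocalState n f p V where
  st := fun j => ((I j).bind fun msg => msg.pref) <|> s.st j
  status := newStatus i m s.status I
  z := newZ i m τ I
  held := fun j => ((I j).bind fun msg => msg.shares) <|> s.held j
  revealed := fun j l => ((I l).bind fun msg => msg.reveal.bind fun g => g j) <|> s.revealed j l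
  hist := I :: s.hist
  decided := s.decided
  out := none

/-- `NC_m` as computed by agent `i` from its last status report: the agents that, as far as `i`
knows, did not crash up to and including round `m`. -/
def NC (i : Fin n) (s : LocalState n f p V) (m : ℕ) : Finset (Fin n) :=
  if m = 0 then Finset.univ
  else Finset.univ.filter fun j => j = i ∨ ∀ m' ≤ m, ∀ l, s.status j ≠ .crashed m' l

/-- The rounds `1 ≤ m ≤ f + 1` that seem clean to agent `i`. -/
def seemsClean (i : Fin n) (s : LocalState n f p V) : Set ℕ :=
  {m | 1 ≤ m ∧ m ≤ f + 1 ∧ NC i s m = NC i s (m - 1)}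

/-- The first round that seems clean to agent `i`. -/
def mStar (i : Fin n) (s : LocalState n f p V) : ℕ := sInf (seemsClean i s)

/-- The tuple of shares `y_{jl}^0, …, y_{jl}^f` of the secrets of `j`, if known to agent `i`: all of
them if `j = i`, and otherwise the share received from `j` in round `1` (for `l = i`) and those
received in round `f + 1`. -/
def knownShares (pt : Fin n → ZMod p) (i : Fin n) (τ : Tape n f p) (s : LocalState n f p V)
    (j l : Fin n) : Option (Shares f p) :=
  if j = i then some (τ.sharesAt (pt l)) else if l = i then s.held j else s.revealed j l

/-- `q` has degree at most `1` and passes through all shares `y_{jl}^t` that agent `i` knows. -/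
def Interpolates (pt : Fin n → ZMod p) (i : Fin n) (τ : Tape n f p) (s : LocalState n f p V)
    (j : Fin n) (t : Fin (f + 1)) (q : (ZMod p)[X]) : Prop :=
  q.degree ≤ 1 ∧ ∀ l y, knownShares pt i τ s j l = some y → q.eval (pt l) = y t

/-- The value of `x_j[t]` that agent `i` computes by interpolation (`0` if there is no unique
interpolating polynomial). -/
def recoveredSecret (pt : Fin n → ZMod p) (i : Fin n) (τ : Tape n f p) (s : LocalState n f p V)
    (j : Fin n) (t : Fin (f + 1)) : ℕ :=
  if h : ∃! q : (ZMod p)[X], Interpolates pt i τ s j t q then (h.choose.eval 0).val else 0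

/-- The agent selected by agent `i` at the end of round `f + 1`: the one with the `(S + 1)`st
highest identifier in `NC_{m*}`, where `S` is the sum of the secrets `x_j[t]`, `j ∈ NC_{m*}`,
modulo `n - t`, and `t = n - |NC_{m*}|`. -/
def dictator (pt : Fin n → ZMod p) (i : Fin n) (τ : Tape n f p) (s : LocalState n f p V) :
    Option (Fin n) :=
  let K := NC i s (mStar i s)
  let t := n - K.card
  let S := (∑ j ∈ K, recoveredSecret pt i τ s j (Fin.ofNat (f + 1) t)) % (n - t)
  (K.sort (fun a b => b ≤ a))[S]?

/-- Update phase of agent `i` in round `m`. -/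
def update (pt : Fin n → ZMod p) (i : Fin n) (m : ℕ) (τ : Tape n f p) (inconsistent : Prop)
    (s : LocalState n f p V) : LocalState n f p V :=
  if inconsistent then { s with decided := true, out := some none }
  else if m ≤ f then s
  else { s with decided := true, out := some ((dictator pt i τ s).bind s.st) }

/-! ### Runs -/

/-- A context together with the coin tosses of all agents; it determines a run. -/
structure Scenario (n f p : ℕ) (V : Type*) where
  F : FailurePattern n
  v : Fin n → V
  ω : Coins n f p

/-- The messages that agent `i` receives in round `m`, if `st` holds the states of all agents at the
start of the round.  Agents that have decided do not send any more. -/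
def inbox (pt : Fin n → ZMod p) (c : Scenario n f p V) (st : Fin n → LocalState n f p V)
    (m : ℕ) (i : Fin n) : Inbox n f p V :=
  fun j =>
    if j ≠ i ∧ c.F.Sends j m i ∧ (st j).decided = false then
      some (message pt (c.v j) (c.ω j) (st j) m i)
    else none

/-- Agent `i` detects an inconsistency in round `m` of `c`: what it knows (its preference, its coin
tosses, and the messages received up to and including round `m`) is inconsistent with all agents
following the protocol except that up to `f` agents may crash.  `prev c'` holds the states of
all agents at the start of round `m` in the run determined by `c'`. -/
def DetectsInconsistency (pt : Fin n → ZMod p)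
    (prev : Scenario n f p V → Fin n → LocalState n f p V)
    (m : ℕ) (c : Scenario n f p V) (i : Fin n) : Prop :=
  ¬ ∃ c' : Scenario n f p V, c'.F.faulty.card ≤ f ∧ c'.F.Survives i m ∧
    c'.v i = c.v i ∧ c'.ω i = c.ω i ∧ (prev c' i).hist = (prev c i).hist ∧
    inbox pt c' (prev c') m i = inbox pt c (prev c) m i

/-- The state of every agent at the end of round `m`, in every run in which all agents follow the
protocol, except that they crash as the failure pattern says. -/
def exec (pt : Fin n → ZMod p) : ℕ → Scenario n f p V → Fin n → LocalState n f p V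
  | 0 => fun c i => initState pt i (c.v i) (c.ω i)
  | m + 1 => fun c i =>
    let s := exec pt m c i
    if c.F.Survives i (m + 1) ∧ s.decided = false ∧ m + 1 ≤ f + 1 then
      update pt i (m + 1) (c.ω i) (DetectsInconsistency pt (exec pt m) (m + 1) c i)
        (receive i (m + 1) (c.ω i) (inbox pt c (exec pt m c) (m + 1) i) s)
    else { s with out := none }

/-- The decisions made in a run of the protocol. -/
def consOutcome (pt : Fin n → ZMod p) (F : FailurePattern n) (v : Fin n → V) (ω : Coins n f p) :
    Outcome n V :=
  fun i m => (exec pt m ⟨F, v, ω⟩ i).out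

/-- The state of agent `i` at the end of round `f + 1`. -/
def finalState (pt : Fin n → ZMod p) (F : FailurePattern n) (v : Fin n → V) (ω : Coins n f p)
    (i : Fin n) : LocalState n f p V :=
  exec pt (f + 1) ⟨F, v, ω⟩ i

end Protocol

end

end FairConsensus

/-! With at most `f` crashes no agent ever detects an inconsistency, and the crash rounds in the
status reports depend on the failure pattern alone. If `l` crashes in round `c`, an agent charges
the crash to round `c` once news of a message missed in that round has reached it, and otherwise to
round `c + 1`, the first round without a message from `l` (`exec_status_time`).

A report charges at most `f` agents, each to one round, so some round among `1, …, f + 1` is charged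
to nobody; the first such round is the first that seems clean. Survivors of round `f + 1` agree on
it (`Learns.of_survives`): if news of a crash in round `c` reached one of them but not another, then
in every round after `c` an informed agent crashed without telling the latter. Together with the
crasher of round `c` and the agents charged to earlier rounds, these are `f + 1` faulty agents. So
the clean round and the set `K` are common and independent of the coins (`exists_first_clean`).

Every member of `K` delivered its first message to all survivors, so each survivor knows two shares
of each of its secrets and recovers the line through them (`interpolates_iff`). All survivors
compute the same sum `S`. Adding `1` to one secret adds `1` to `S` modulo `|K|`, so `S` is uniform
(`prob_sum_secret`) and the dictator is uniform on `K`. As `K` contains the correct agents and `|K|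
≤ n`, fairness follows by summing over the correct agents with the given preference. -/

namespace FairConsensus

noncomputable section

open scoped Classical

/-! ### Spread of crash reports, determined by the failure pattern -/

namespace FailurePattern

variable {n : ℕ} (F : FailurePattern n)

/-- If `l` crashes in round `c`, then `F.Learns l c m i` says that by the end of round `m` agent `i`
has learned, directly or through a chain of messages, that `l` failed to send in round `c`. -/
def Learns (l : Fin n) (c : ℕ) : ℕ → Fin n → Prop
  | 0, _ => False
  | m + 1, i => (m + 1 = c ∧ ¬ F.Sends l c i) ∨ Learns l c m i ∨
      ∃ k, k ≠ i ∧ F.Sends k (m + 1) i ∧ Learns l c m k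

/-- The crash round of `l` known to agent `i` at the end of round `m`, and `⊤` if there is none. -/
def reportTime (m : ℕ) (i l : Fin n) : ℕ∞ :=
  match F.fail l with
  | none => ⊤
  -- An agent without the news still misses the message of `l` in round `c + 1`, hence the value `c
  -- + 1` from that round on.
  | some (c, _) => if F.Learns l c m i then (c : ℕ∞) else if c < m then ((c + 1 : ℕ) : ℕ∞) else ⊤

variable {F} {l i j k : Fin n} {c m m' r : ℕ} {A : Finset (Fin n)}

lemma Correct.survives (h : F.Correct i) (m : ℕ) : F.Survives i m := by
  intro c A hc
  rw [Correct] at h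
  simp [h] at hc

lemma Survives.mono (h : F.Survives i m) (hm : m' ≤ m) : F.Survives i m' :=
  fun c A hc => hm.trans_lt (h c A hc)

lemma Survives.sends (h : F.Survives i m) : F.Sends i m j :=
  fun c A hc => Or.inl (h c A hc)

lemma Sends.survives (h : F.Sends i (m + 1) j) : F.Survives i m := by
  intro c A hc
  rcases h c A hc with h | h <;> omega

lemma not_sends_of_lt (hl : F.fail l = some (c, A)) (hm : c < m) : ¬ F.Sends l m i := by
  intro h
  rcases h c A hl with h | h <;> omega

lemma exists_fail_of_not_sends (h : ¬ F.Sends l m i) : ∃ c A, F.fail l = some (c, A) ∧ c ≤ m := by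
  simp only [Sends, not_forall, not_or] at h
  obtain ⟨c, A, hc, h, -⟩ := h
  exact ⟨c, A, hc, not_lt.1 h⟩

lemma mem_faulty (hl : F.fail l = some (c, A)) : l ∈ F.faulty := by
  rw [faulty, Finset.mem_filter, Correct, hl]
  simp

lemma Learns.le (h : F.Learns l c m i) : c ≤ m := by
  induction m generalizing i with
  | zero => exact h.elim
  | succ m ih =>
    rcases h with h | h | ⟨k, -, -, h⟩
    · exact h.1.ge
    · exact (ih h).trans m.le_succ
    · exact (ih h).trans m.le_succ

lemma Learns.mono (h : F.Learns l c m i) (hm : m ≤ r) : F.Learns l c r i := by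
  induction hm with
  | refl => exact h
  | step _ ih => exact Or.inr (Or.inl ih)

lemma Learns.tell (h : F.Learns l c m k) (hk : F.Sends k (m + 1) i) : F.Learns l c (m + 1) i := by
  by_cases hki : k = i
  · subst hki
    exact h.mono m.le_succ
  · exact Or.inr (Or.inr ⟨k, hki, hk, h⟩)

/-- Follow the chain of messages backwards: whoever passed the news on in round `m + 1` sent in that
round, so it survived round `m`. -/
lemma Learns.exists_at (h : F.Learns l c r i) (hi : F.Survives i r) (hc : c ≤ m) (hm : m ≤ r) :
    ∃ k, F.Learns l c m k ∧ F.Survives k m := by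
  induction hm using Nat.decreasingInduction with
  | self => exact ⟨i, h, hi⟩
  | of_succ m hm ih =>
    obtain ⟨k, hk, hs⟩ := ih (hc.trans m.le_succ)
    rcases hk with hk | hk | ⟨k', -, hk', hk⟩
    · omega
    · exact ⟨k, hk, hs.mono m.le_succ⟩
    · exact ⟨k', hk, hk'.survives⟩

lemma reportTime_of_correct (hl : F.Correct l) : F.reportTime m i l = ⊤ := by
  rw [Correct] at hl
  simp [reportTime, hl]

lemma reportTime_of_fail (hl : F.fail l = some (c, A)) : F.reportTime m i l =
    if F.Learns l c m i then (c : ℕ∞) else if c < m then ((c + 1 : ℕ) : ℕ∞) else ⊤ := by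
  simp [reportTime, hl]

lemma le_reportTime (hl : F.fail l = some (c, A)) : (c : ℕ∞) ≤ F.reportTime m i l := by
  rw [reportTime_of_fail hl]
  split_ifs
  · exact le_rfl
  · exact_mod_cast c.le_succ
  · exact le_top

lemma reportTime_of_le (hl : F.fail l = some (c, A)) (hm : m < c) : F.reportTime m i l = ⊤ := by
  rw [reportTime_of_fail hl, if_neg (fun h => by have := h.le; omega), if_neg (by omega)]

lemma reportTime_of_survives (hl : F.Survives l m) : F.reportTime m i l = ⊤ := by
  by_cases h : F.Correct l
  · exact reportTime_of_correct h
  · obtain ⟨⟨c, A⟩, hc⟩ := Option.ne_none_iff_exists'.1 h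
    exact reportTime_of_le hc (hl c A hc)

lemma exists_fail_of_reportTime (h : F.reportTime m i l = (r : ℕ∞)) :
    ∃ c A, F.fail l = some (c, A) ∧ c ≤ r := by
  by_cases hl : F.Correct l
  · simp [reportTime_of_correct hl] at h
  · obtain ⟨⟨c, A⟩, hc⟩ := Option.ne_none_iff_exists'.1 hl
    have := le_reportTime (m := m) (i := i) hc
    rw [h] at this
    exact ⟨c, A, hc, by exact_mod_cast this⟩

lemma reportTime_pos : 0 < F.reportTime m i l := by
  by_cases hl : F.Correct l
  · simp [reportTime_of_correct hl]
  · obtain ⟨⟨c, A⟩, hc⟩ := Option.ne_none_iff_exists'.1 hl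
    exact lt_of_lt_of_le (by exact_mod_cast F.round_pos l c A hc) (le_reportTime hc)

/-- An agent that misses a message in the first round knows a crash round `1`. -/
lemma reportTime_eq_one (h : ¬ F.Sends l 1 i) (hm : 1 ≤ m) : F.reportTime m i l = 1 := by
  obtain ⟨c, A, hc, hc1⟩ := exists_fail_of_not_sends h
  obtain rfl : c = 1 := le_antisymm hc1 (F.round_pos l c A hc)
  have : F.Learns l 1 1 i := Or.inl ⟨rfl, h⟩
  rw [reportTime_of_fail hc, if_pos (this.mono hm), Nat.cast_one]

/-- If more than `f` rounds each had a crash charged to a different agent, there would be too many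
crashes. -/
lemma false_of_forall_round {f : ℕ} (hF : F.faulty.card ≤ f) (g : ℕ → Fin n)
    (hg : ∀ r ∈ Finset.Icc 1 (f + 1), g r ∈ F.faulty)
    (hinj : Set.InjOn g (Finset.Icc 1 (f + 1) : Finset ℕ)) : False := by
  have := Finset.card_le_card_of_injOn g hg hinj
  rw [Nat.card_Icc] at this
  omega

/-- Pigeonhole: a report charges each faulty agent to only one round, and there are more rounds than
faulty agents. -/
lemma exists_round_not_reported {f : ℕ} (hF : F.faulty.card ≤ f) (i : Fin n) :
    ∃ r, 1 ≤ r ∧ r ≤ f + 1 ∧ ∀ j, F.reportTime m i j ≠ (r : ℕ∞) := by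
  by_contra! h
  have : Nonempty (Fin n) := ⟨i⟩
  choose! g hg using h
  refine false_of_forall_round hF g (fun r hr => ?_) (fun r hr r' hr' h => ?_)
  · rw [Finset.mem_Icc] at hr
    obtain ⟨c, A, hc, -⟩ := exists_fail_of_reportTime (hg r hr.1 hr.2)
    exact mem_faulty hc
  · simp only [Finset.coe_Icc, Set.mem_Icc] at hr hr'
    have h1 := hg r hr.1 hr.2
    have h2 := hg r' hr'.1 hr'.2
    rw [h, h2] at h1
    exact_mod_cast h1.symm

/-- If each round before the crash round `c` of `l` is reported to some agent as the crash round of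
somebody, then the agents surviving round `f + 1` agree on whether `l` crashed in round `c`: otherwise
the information would have been passed on by agents crashing in each of the rounds after `c`. -/
lemma Learns.of_survives {f : ℕ} (hF : F.faulty.card ≤ f) {i₀ i i' : Fin n}
    (hl : F.fail l = some (c, A)) (hi : F.Survives i (f + 1))
    (hrep : ∀ r, 1 ≤ r → r < c → ∃ j, F.reportTime m i₀ j = (r : ℕ∞))
    (h : F.Learns l c (f + 1) i) : F.Learns l c (f + 1) i' := by
  by_contra hn
  -- An informed agent `k` survives round `r - 1`; had it sent to `i'` in round `r`, then `i'` would
  -- know. So `k` crashes exactly in round `r`.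
  have hcrash : ∀ r, c < r → r ≤ f + 1 → ∃ k B, F.fail k = some (r, B) := by
    intro r hcr hr
    obtain ⟨r, rfl⟩ : ∃ s, r = s + 1 := ⟨r - 1, by omega⟩
    obtain ⟨k, hk, hks⟩ := h.exists_at hi (Nat.lt_succ_iff.1 hcr) (by omega : r ≤ f + 1)
    have hns : ¬ F.Sends k (r + 1) i' := fun hs => hn ((hk.tell hs).mono hr)
    obtain ⟨b, B, hb, hbr⟩ := exists_fail_of_not_sends hns
    obtain rfl : b = r + 1 := le_antisymm hbr (hks b B hb)
    exact ⟨k, B, hb⟩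
  have : Nonempty (Fin n) := ⟨i⟩
  choose! g₁ hg₁ using hrep
  choose! g₂ B hg₂ using hcrash
  -- One faulty agent per round. Those for rounds before `c` crashed before `c` and differ by their
  -- reported rounds; the others crashed in the very round they stand for.
  let g : ℕ → Fin n := fun r => if r < c then g₁ r else if r = c then l else g₂ r
  have hfail : ∀ r, 1 ≤ r → r ≤ f + 1 → ∃ b D, F.fail (g r) = some (b, D) ∧
      ((r < c ∧ b < c ∧ F.reportTime m i₀ (g r) = (r : ℕ∞)) ∨ (c ≤ r ∧ b = r)) := by
    intro r h1 h2
    rcases lt_trichotomy r c with hr | hr | hr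
    · have hgr : g r = g₁ r := by simp [g, hr]
      obtain ⟨b, D, hb, hbr⟩ := exists_fail_of_reportTime (hg₁ r h1 hr)
      exact ⟨b, D, hgr ▸ hb, Or.inl ⟨hr, hbr.trans_lt hr, hgr ▸ hg₁ r h1 hr⟩⟩
    · subst hr
      have hgr : g r = l := by simp [g]
      exact ⟨r, A, hgr ▸ hl, Or.inr ⟨le_rfl, rfl⟩⟩
    · have hgr : g r = g₂ r := by simp [g, hr.not_gt, hr.ne']
      exact ⟨r, B r, hgr ▸ hg₂ r hr h2, Or.inr ⟨hr.le, rfl⟩⟩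
  refine false_of_forall_round hF g (fun r hr => ?_) (fun r hr r' hr' hrr' => ?_)
  · rw [Finset.mem_Icc] at hr
    obtain ⟨b, D, hb, -⟩ := hfail r hr.1 hr.2
    exact mem_faulty hb
  · simp only [Finset.coe_Icc, Set.mem_Icc] at hr hr'
    obtain ⟨b, D, hb, hc⟩ := hfail r hr.1 hr.2
    obtain ⟨b', D', hb', hc'⟩ := hfail r' hr'.1 hr'.2
    rw [hrr', hb', Option.some.injEq, Prod.mk.injEq] at hb
    obtain ⟨rfl, -⟩ := hb
    rcases hc with ⟨h1, h2, h3⟩ | ⟨h1, h2⟩ <;> rcases hc' with ⟨h1', h2', h3'⟩ | ⟨h1', h2'⟩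
    · rw [hrr', h3'] at h3
      exact_mod_cast h3.symm
    all_goals omega

/-- Agents surviving round `f + 1` agree on all crash rounds up to a round `m₀` before which all
rounds are reported as crash rounds. -/
lemma lt_reportTime_iff {f m₀ : ℕ} (hF : F.faulty.card ≤ f) {i₀ i : Fin n}
    (hi₀ : F.Survives i₀ (f + 1)) (hi : F.Survives i (f + 1))
    (hrep : ∀ r, 1 ≤ r → r < m₀ → ∃ j, F.reportTime (f + 1) i₀ j = (r : ℕ∞))
    (hr : r ≤ m₀) (l : Fin n) :
    (r : ℕ∞) < F.reportTime (f + 1) i l ↔ (r : ℕ∞) < F.reportTime (f + 1) i₀ l := by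
  by_cases hl : F.Correct l
  · simp [reportTime_of_correct hl]
  obtain ⟨⟨c, A⟩, hc⟩ := Option.ne_none_iff_exists'.1 hl
  by_cases hcm : c ≤ m₀
  · have hrep' : ∀ r, 1 ≤ r → r < c → ∃ j, F.reportTime (f + 1) i₀ j = (r : ℕ∞) :=
      fun r h1 h2 => hrep r h1 (by omega)
    have : F.Learns l c (f + 1) i ↔ F.Learns l c (f + 1) i₀ :=
      ⟨Learns.of_survives hF hc hi hrep', Learns.of_survives hF hc hi₀ hrep'⟩
    simp only [reportTime_of_fail hc, this]
  -- A crash is never charged to a round before it happens, so both sides hold.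
  · have hrc : (r : ℕ∞) < c := by exact_mod_cast (by omega : r < c)
    exact iff_of_true (hrc.trans_le (le_reportTime hc)) (hrc.trans_le (le_reportTime hc))

end FailurePattern

/-! ### Local states of a run, expressed through the failure pattern -/

section Exec

variable {n f p : ℕ} {V : Type*} {pt : Fin n → ZMod p} {c : Scenario n f p V} {i j l : Fin n}
  {m : ℕ}

/-- The actual run is itself a run with at most `f` crashes that explains what `i` has seen. -/
lemma not_detectsInconsistency (hF : c.F.faulty.card ≤ f) (hi : c.F.Survives i m)
    (prev : Scenario n f p V → Fin n → LocalState n f p V) :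
    ¬ DetectsInconsistency pt prev m c i :=
  fun h => h ⟨c, hF, hi, rfl, rfl, rfl, rfl⟩

lemma exec_decided (hF : c.F.faulty.card ≤ f) (hm : m ≤ f) (i : Fin n) :
    (exec pt m c i).decided = false := by
  induction m with
  | zero => rfl
  | succ m ih =>
    have ih := ih (by omega)
    rw [exec]
    by_cases hs : c.F.Survives i (m + 1)
    · simp only [hs, ih, true_and]
      rw [if_pos (by omega), update, if_neg (not_detectsInconsistency hF hs _), if_pos hm]
      exact ih
    · simp [hs, ih]

lemma exec_succ (hF : c.F.faulty.card ≤ f) (hm : m ≤ f) (hs : c.F.Survives i (m + 1)) :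
    exec pt (m + 1) c i =
      let s := receive i (m + 1) (c.ω i) (inbox pt c (exec pt m c) (m + 1) i) (exec pt m c i)
      if m + 1 ≤ f then s
      else { s with decided := true, out := some ((dictator pt i (c.ω i) s).bind s.st) } := by
  rw [exec]
  simp only [hs, exec_decided hF hm, true_and]
  rw [if_pos (by omega), update, if_neg (not_detectsInconsistency hF hs _)]

lemma inbox_eq (hF : c.F.faulty.card ≤ f) (hm : m ≤ f) (i j : Fin n) :
    inbox pt c (exec pt m c) (m + 1) i j = if j ≠ i ∧ c.F.Sends j (m + 1) i then
      some (message pt (c.v j) (c.ω j) (exec pt m c j) (m + 1) i) else none := by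
  simp only [inbox, exec_decided hF hm, and_true]

lemma exec_succ_status (hF : c.F.faulty.card ≤ f) (hm : m ≤ f) (hs : c.F.Survives i (m + 1)) :
    (exec pt (m + 1) c i).status =
      newStatus i (m + 1) (exec pt m c i).status (inbox pt c (exec pt m c) (m + 1) i) := by
  rw [exec_succ hF hm hs]
  dsimp only
  split_ifs <;> rfl

lemma exec_st (hF : c.F.faulty.card ≤ f) (hm : m ≤ f + 1) (hs : c.F.Survives i m) (j : Fin n) :
    (exec pt m c i).st j =
      if j = i ∨ (1 ≤ m ∧ c.F.Sends j 1 i) then some (c.v j) else none := by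
  induction m with
  | zero =>
    by_cases hj : j = i <;> simp [exec, initState, hj]
  | succ m ih =>
    have ih := ih (by omega) (hs.mono m.le_succ)
    have : (exec pt (m + 1) c i).st j =
        (((inbox pt c (exec pt m c) (m + 1) i j).bind fun msg => msg.pref) <|>
          (exec pt m c i).st j) := by
      rw [exec_succ hF (by omega) hs]
      dsimp only
      split_ifs <;> rfl
    rw [this, inbox_eq hF (by omega), ih]
    by_cases hj : j = i
    · simp [hj]
    · rcases Nat.eq_zero_or_pos m with rfl | hm0
      · by_cases h1 : c.F.Sends j 1 i <;> simp [hj, h1, message]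
      · have h1 : m + 1 ≠ 1 := by omega
        by_cases h2 : c.F.Sends j (m + 1) i <;>
          simp [hj, h2, message, hm0.ne', Nat.one_le_iff_ne_zero]

lemma exec_held (hF : c.F.faulty.card ≤ f) (hm : m ≤ f + 1) (hs : c.F.Survives i m) (j : Fin n) :
    (exec pt m c i).held j =
      if j = i ∨ (1 ≤ m ∧ c.F.Sends j 1 i) then some ((c.ω j).sharesAt (pt i)) else none := by
  induction m with
  | zero =>
    by_cases hj : j = i <;> simp [exec, initState, hj]
  | succ m ih =>
    have ih := ih (by omega) (hs.mono m.le_succ)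
    have : (exec pt (m + 1) c i).held j =
        (((inbox pt c (exec pt m c) (m + 1) i j).bind fun msg => msg.shares) <|>
          (exec pt m c i).held j) := by
      rw [exec_succ hF (by omega) hs]
      dsimp only
      split_ifs <;> rfl
    rw [this, inbox_eq hF (by omega), ih]
    by_cases hj : j = i
    · simp [hj]
    · rcases Nat.eq_zero_or_pos m with rfl | hm0
      · by_cases h1 : c.F.Sends j 1 i <;> simp [hj, h1, message]
      · have h1 : m + 1 ≠ 1 := by omega
        by_cases h2 : c.F.Sends j (m + 1) i <;>
          simp [hj, h2, message, hm0.ne', Nat.one_le_iff_ne_zero]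

/-- Shares are revealed in round `f + 1` only, out of what the sender held at the end of round `f`.
For `f = 0` that is the initial state. -/
lemma exec_succ_revealed (hF : c.F.faulty.card ≤ f) (hm : m ≤ f) (hs : c.F.Survives i (m + 1))
    (j l : Fin n) : (exec pt (m + 1) c i).revealed j l =
      if m = f ∧ (l ≠ i ∧ j ≠ i) ∧ c.F.Sends l (f + 1) i then (exec pt f c l).held j else none := by
  have key : ∀ m ≤ f, c.F.Survives i (m + 1) → (exec pt (m + 1) c i).revealed j l =
        (((inbox pt c (exec pt m c) (m + 1) i l).bind fun msg => msg.reveal.bind fun g => g j) <|>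
          (exec pt m c i).revealed j l) := by
    intro m hm hs
    rw [exec_succ hF hm hs]
    dsimp only
    split_ifs <;> rfl
  have h0 : ∀ m ≤ f, c.F.Survives i m → (exec pt m c i).revealed j l = none := by
    intro m
    induction m with
    | zero => exact fun _ _ => rfl
    | succ m ih =>
      intro hm hs
      have h1 : ¬ m = f := by omega
      rw [key m (by omega) hs, ih (by omega) (hs.mono m.le_succ), inbox_eq hF (by omega)]
      split_ifs <;> simp [message, h1]
  rw [key m hm hs, h0 m hm (hs.mono m.le_succ), inbox_eq hF hm]
  by_cases hmf : m = f
  · subst hmf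
    by_cases h1 : l = i
    · simp [h1]
    · by_cases h2 : c.F.Sends l (m + 1) i <;> by_cases h3 : j = i <;> simp [h1, h2, h3, message]
  · split_ifs <;> simp_all [message]

/-- If processing any list member preserves a property of the entry and the value `a` of its crash
round, and some member sets the crash round to `a`, then `a` is the result of the loop. -/
lemma foldl_time_eq {α : Type*} (S : Status n → Prop) (a : ℕ∞) (step : Status n → α → Status n)
    (L : List α) (hS : ∀ e, ∀ x ∈ L, S e → S (step e x))
    (ha : ∀ e, ∀ x ∈ L, e.time = a → (step e x).time = a)
    {e : Status n} (he : S e) (hex : e.time = a ∨ ∃ x ∈ L, ∀ e, S e → (step e x).time = a) :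
    (L.foldl step e).time = a := by
  induction L generalizing e with
  | nil => simpa using hex
  | cons y L ih =>
    rw [List.foldl_cons]
    refine ih (fun e x hx => hS e x (List.mem_cons_of_mem y hx))
      (fun e x hx => ha e x (List.mem_cons_of_mem y hx)) (hS e y List.mem_cons_self he) ?_
    rcases hex with h | ⟨x, hx, h⟩
    · exact Or.inl (ha e y List.mem_cons_self h)
    · rcases List.mem_cons.1 hx with rfl | hx
      · exact Or.inl (h e he)
      · exact Or.inr ⟨x, hx, h⟩

lemma statusStep_of_some {I : Inbox n f p V} {msg : Message n f p V} {old : Fin n → Status n}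
    {e : Status n} (h : I j = some msg) (hlj : l ≠ j) :
    (statusStep i m old I l e j).time =
      if (msg.status l).time < (old l).time then (msg.status l).time else e.time := by
  simp only [statusStep, h, if_neg hlj]
  rcases hm : msg.status l with z | ⟨m', k⟩
  · simp [Status.time]
  · exact apply_ite Status.time _ _ _

lemma statusStep_of_some_self {I : Inbox n f p V} {msg : Message n f p V} {old : Fin n → Status n}
    {e : Status n} (h : I l = some msg) : (statusStep i m old I l e l).time = ⊤ := by
  simp [statusStep, h, Status.time]

lemma statusStep_of_none {I : Inbox n f p V} {old : Fin n → Status n}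
    {e : Status n} (h : I j = none) (hlj : l ≠ j) : statusStep i m old I l e j = e := by
  simp [statusStep, h, hlj]

lemma statusStep_of_none_self {I : Inbox n f p V} {old : Fin n → Status n}
    {e : Status n} (h : I l = none) :
    (statusStep i m old I l e l).time = if e.time = ⊤ then (m : ℕ∞) else e.time := by
  rcases e with z | ⟨m', k⟩ <;> simp [statusStep, h, Status.time]

lemma exec_status_self (hF : c.F.faulty.card ≤ f) (hm : m ≤ f + 1) (hs : c.F.Survives i m) :
    ((exec pt m c i).status i).time = ⊤ := by
  induction m with
  | zero => rfl
  | succ m ih =>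
    rw [exec_succ_status hF (by omega) hs, newStatus, if_pos rfl]
    exact ih (by omega) (hs.mono m.le_succ)

/-- Since the only possible times for `l` are its crash round, the next round and `⊤`, merging
reports by taking smaller times amounts to propagating the news that `Learns` describes. -/
theorem exec_status_time (hF : c.F.faulty.card ≤ f) (hm : m ≤ f + 1) (hs : c.F.Survives i m)
    (l : Fin n) : ((exec pt m c i).status l).time = c.F.reportTime m i l := by
  induction m generalizing i with
  | zero =>
    have : c.F.Survives l 0 := fun b B hb => c.F.round_pos l b B hb
    rw [FailurePattern.reportTime_of_survives this]
    rfl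
  | succ m ih =>
    by_cases hli : l = i
    · subst hli
      rw [exec_status_self hF hm hs, FailurePattern.reportTime_of_survives hs]
    have hmf : m ≤ f := by omega
    have hold := ih (by omega) (hs.mono m.le_succ)
    rw [exec_succ_status hF hmf hs, newStatus, if_neg hli]
    set old := (exec pt m c i).status
    set I := inbox pt c (exec pt m c) (m + 1) i with hI
    have hsome : ∀ j, j ≠ i → c.F.Sends j (m + 1) i → ∃ msg : Message n f p V, I j = some msg ∧
        (msg.status l).time = c.F.reportTime m j l := by
      intro j hj hsj
      exact ⟨_, by rw [hI, inbox_eq hF hmf, if_pos ⟨hj, hsj⟩], ih (by omega) hsj.survives⟩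
    have hnone : ∀ j, ¬ c.F.Sends j (m + 1) i → I j = none := by
      intro j hsj
      rw [hI, inbox_eq hF hmf, if_neg (fun h => hsj h.2)]
    set L := (List.finRange n).filter (fun j => j ≠ i) with hL
    have hmem : ∀ j, j ∈ L ↔ j ≠ i := fun j => by simp [hL]
    by_cases hsl : c.F.Sends l (m + 1) i
    · -- nobody knows of a crash of `l`
      have htop : ∀ j, c.F.reportTime m j l = ⊤ := fun j =>
        FailurePattern.reportTime_of_survives hsl.survives
      have hres : c.F.reportTime (m + 1) i l = ⊤ := by
        by_cases hc : c.F.Correct l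
        · exact FailurePattern.reportTime_of_correct hc
        obtain ⟨⟨b, B⟩, hb⟩ := Option.ne_none_iff_exists'.1 hc
        have hmb := hsl.survives b B hb
        rw [FailurePattern.reportTime_of_fail hb, if_neg, if_neg (by omega)]
        rintro (⟨rfl, h⟩ | h | ⟨k, -, -, h⟩)
        · exact h hsl
        all_goals exact absurd h.le (by omega)
      rw [hres]
      have hstep : ∀ e : Status n, ∀ j ∈ L, e.time = ⊤ →
          (statusStep i (m + 1) old I l e j).time = ⊤ := by
        intro e j hj he
        rw [hmem] at hj
        by_cases hlj : l = j
        · subst hlj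
          obtain ⟨msg, h, -⟩ := hsome l hj hsl
          exact statusStep_of_some_self h
        · by_cases hsj : c.F.Sends j (m + 1) i
          · obtain ⟨msg, h, ht⟩ := hsome j hj hsj
            rw [statusStep_of_some h hlj, ht, htop, if_neg not_top_lt, he]
          · rw [statusStep_of_none (hnone j hsj) hlj, he]
      exact foldl_time_eq (fun _ => True) ⊤ _ L (fun _ _ _ _ => trivial) hstep trivial
        (Or.inl (by rw [hold, htop]))
    · obtain ⟨b, B, hb, hbm⟩ := FailurePattern.exists_fail_of_not_sends hsl
      have hIl := hnone l hsl
      have hrep : ∀ j, c.F.reportTime m j l = if c.F.Learns l b m j then (b : ℕ∞) else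
          if b < m then ((b + 1 : ℕ) : ℕ∞) else ⊤ := fun j => FailurePattern.reportTime_of_fail hb
      have hsender : ∀ j, c.F.Sends j (m + 1) i → b ≤ m → l ≠ j := by
        rintro j hj hbm rfl
        exact FailurePattern.not_sends_of_lt hb (by omega) hj
      by_cases hex : c.F.Learns l b m i ∨ ∃ k, k ≠ i ∧ c.F.Sends k (m + 1) i ∧ c.F.Learns l b m k
      · -- the crash round `b` is already known or reported
        have hbm' : b ≤ m := by
          rcases hex with h | ⟨k, -, -, h⟩ <;> exact h.le
        have hres : c.F.reportTime (m + 1) i l = b := by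
          have hlearn : c.F.Learns l b (m + 1) i := Or.inr hex
          rw [FailurePattern.reportTime_of_fail hb, if_pos hlearn]
        rw [hres]
        refine foldl_time_eq (fun e => True) b _ L (fun _ _ _ _ => trivial) ?_ trivial ?_
        · intro e j hj he
          rw [hmem] at hj
          by_cases hsj : c.F.Sends j (m + 1) i
          · obtain ⟨msg, h, ht⟩ := hsome j hj hsj
            rw [statusStep_of_some h (hsender j hsj hbm'), ht, hold]
            split_ifs with hlt
            · rw [hrep j]
              refine if_pos ?_
              -- An uninformed sender has the same time as an uninformed `i`, and a larger one than
              -- an informed `i`; so a strictly smaller time can only be `b`.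
              by_contra hnl
              rw [hrep j, if_neg hnl, hrep i] at hlt
              by_cases hL : c.F.Learns l b m i
              · rw [if_pos hL] at hlt
                split_ifs at hlt with h2
                · exact absurd hlt (by simp)
                · simp at hlt
              · rw [if_neg hL] at hlt
                exact lt_irrefl _ hlt
            · exact he
          · by_cases hlj : l = j
            · subst hlj
              rw [statusStep_of_none_self hIl, he, if_neg (by simp)]
            · rw [statusStep_of_none (hnone j hsj) hlj, he]
        · by_cases hL : c.F.Learns l b m i
          · exact Or.inl (by rw [hold, hrep, if_pos hL])
          · obtain ⟨k, hki, hk, hkl⟩ := hex.resolve_left hL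
            refine Or.inr ⟨k, (hmem k).2 hki, fun e _ => ?_⟩
            obtain ⟨msg, h, ht⟩ := hsome k hki hk
            rw [statusStep_of_some h (hsender k hk hbm'), ht, hold, hrep k, if_pos hkl, hrep i,
              if_neg hL, if_pos]
            split_ifs
            · exact_mod_cast b.lt_succ_self
            · simp
      · -- no agent heard by `i` knows the crash round `b`
        rw [not_or] at hex
        obtain ⟨hL, hK⟩ := hex
        push Not at hK
        -- When `b ≥ m` the missing message is charged to round `m + 1`: as the crash round if `b =
        -- m + 1`, as the round after it if `b = m`.
        have hres : c.F.reportTime (m + 1) i l =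
            if b < m then ((b + 1 : ℕ) : ℕ∞) else (m + 1 : ℕ) := by
          rw [FailurePattern.reportTime_of_fail hb]
          by_cases h1 : m + 1 = b
          · have h2 : c.F.Learns l b (m + 1) i := Or.inl ⟨h1, h1 ▸ hsl⟩
            rw [if_pos h2, if_neg (by omega), h1]
          · rw [if_neg, if_pos (by omega)]
            · split_ifs
              · rfl
              · rw [show b = m by omega]
            · rintro (⟨h, -⟩ | h | ⟨k, h1, h2, h3⟩)
              exacts [h1 h, hL h, hK k h1 h2 h3]
        have hold' : (old l).time = if b < m then ((b + 1 : ℕ) : ℕ∞) else ⊤ := by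
          rw [hold, hrep, if_neg hL]
        rw [hres]
        have hstep : ∀ e : Status n, ∀ j, j ≠ i → j ≠ l →
            (statusStep i (m + 1) old I l e j).time = e.time := by
          intro e j hj hjl
          by_cases hsj : c.F.Sends j (m + 1) i
          · obtain ⟨msg, h, ht⟩ := hsome j hj hsj
            rw [statusStep_of_some h hjl.symm, ht, hrep, if_neg (hK j hj hsj), hold',
              if_neg (lt_irrefl _)]
          · rw [statusStep_of_none (hnone j hsj) hjl.symm]
        split_ifs at hold' ⊢ with hbm'
        · refine foldl_time_eq (fun e => True) _ _ L (fun _ _ _ _ => trivial) ?_ trivial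
            (Or.inl hold')
          intro e j hj he
          rw [hmem] at hj
          by_cases hjl : j = l
          · subst hjl
            rw [statusStep_of_none_self hIl, if_neg (by rw [he]; exact ENat.natCast_ne_top _), he]
          · rw [hstep e j hj hjl, he]
        -- Only the pass for `l` itself changes the time, from `⊤` to `m + 1`.
        · refine foldl_time_eq (fun e => e.time = ⊤ ∨ e.time = ((m + 1 : ℕ) : ℕ∞)) _ _ L ?_ ?_
            (Or.inl hold') (Or.inr ⟨l, (hmem l).2 hli, ?_⟩)
          · intro e j hj he
            rw [hmem] at hj
            by_cases hjl : j = l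
            · subst hjl
              rw [statusStep_of_none_self hIl]
              split_ifs with h
              · exact Or.inr rfl
              · exact he
            · rw [hstep e j hj hjl]
              exact he
          · intro e j hj he
            rw [hmem] at hj
            by_cases hjl : j = l
            · subst hjl
              rw [statusStep_of_none_self hIl, he]
              exact ite_id _
            · rw [hstep e j hj hjl, he]
          · intro e he
            rw [statusStep_of_none_self hIl]
            rcases he with he | he
            · rw [if_pos he]
            · rw [he]
              exact ite_id _

end Exec

/-! ### Agreement on the first clean round -/

namespace FailurePattern

variable {n f : ℕ} {F : FailurePattern n}

lemma exists_correct_ne (hf : f + 1 < n) (hF : F.faulty.card ≤ f) (i : Fin n) :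
    ∃ l, l ≠ i ∧ F.Correct l := by
  have hcard : (insert i F.faulty).card < (Finset.univ : Finset (Fin n)).card := by
    have := Finset.card_insert_le i F.faulty
    rw [Finset.card_univ, Fintype.card_fin]
    omega
  obtain ⟨l, -, hl⟩ := Finset.exists_mem_notMem_of_card_lt_card hcard
  rw [Finset.mem_insert, not_or, faulty, Finset.mem_filter, not_and, not_not] at hl
  exact ⟨l, hl.1, hl.2 (Finset.mem_univ l)⟩

/-- Ensures `n - |K| ≤ f`, so that secrets for `t = n - |K|` have been drawn. -/
lemma le_card_of_correct_mem (hF : F.faulty.card ≤ f) {K : Finset (Fin n)}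
    (hK : ∀ i, F.Correct i → i ∈ K) : n ≤ K.card + f := by
  have hsub : Finset.univ ⊆ K ∪ F.faulty := by
    intro i _
    by_cases hi : F.Correct i
    · exact Finset.mem_union_left _ (hK i hi)
    · exact Finset.mem_union_right _ (Finset.mem_filter.2 ⟨Finset.mem_univ i, hi⟩)
  have := (Finset.card_le_card hsub).trans (Finset.card_union_le _ _)
  rw [Finset.card_univ, Fintype.card_fin] at this
  omega

/-- Splits an equality into threshold comparisons, the form in which `lt_reportTime_iff` gives
agreement. -/
lemma enat_eq_iff {x : ℕ∞} {r : ℕ} (hr : 1 ≤ r) :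
    x = (r : ℕ∞) ↔ ((r - 1 : ℕ) : ℕ∞) < x ∧ ¬ (r : ℕ∞) < x := by
  cases x with
  | top => simp
  | coe x =>
    norm_cast
    omega

/-- The agents surviving round `f + 1` agree on the first round `m` to which no crash is charged and
on the set of agents to which no crash up to round `m` is charged. -/
theorem exists_first_clean (hf : f + 1 < n) (hF : F.faulty.card ≤ f) :
    ∃ (m : ℕ) (K : Finset (Fin n)), 1 ≤ m ∧ m ≤ f + 1 ∧
      ∀ i, F.Survives i (f + 1) → (∀ j, j ∈ K ↔ (m : ℕ∞) < F.reportTime (f + 1) i j) ∧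
        (∀ j, F.reportTime (f + 1) i j ≠ (m : ℕ∞)) ∧
        ∀ r, 1 ≤ r → r < m → ∃ j, F.reportTime (f + 1) i j = (r : ℕ∞) := by
  obtain ⟨i₀, -, h₀⟩ := exists_correct_ne hf hF ⟨0, by omega⟩
  have hi₀ := h₀.survives (f + 1)
  have hex := F.exists_round_not_reported (m := f + 1) hF i₀
  set m := Nat.find hex with hm
  obtain ⟨h1, h2, h3⟩ := Nat.find_spec hex
  rw [← hm] at h1 h2 h3
  -- Minimality of `m` supplies the hypothesis of `lt_reportTime_iff`.
  have hrep : ∀ r, 1 ≤ r → r < m → ∃ j, F.reportTime (f + 1) i₀ j = (r : ℕ∞) := by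
    intro r hr hrm
    have := Nat.find_min hex hrm
    push Not at this
    exact this hr (by omega)
  refine ⟨m, Finset.univ.filter fun j => (m : ℕ∞) < F.reportTime (f + 1) i₀ j, h1, h2,
    fun i hi => ?_⟩
  have hlt : ∀ r ≤ m, ∀ j, (r : ℕ∞) < F.reportTime (f + 1) i j ↔
      (r : ℕ∞) < F.reportTime (f + 1) i₀ j := fun r hr j =>
    lt_reportTime_iff hF hi₀ hi hrep hr j
  have heq : ∀ r, 1 ≤ r → r ≤ m → ∀ j, F.reportTime (f + 1) i j = (r : ℕ∞) ↔
      F.reportTime (f + 1) i₀ j = (r : ℕ∞) := by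
    intro r hr hrm j
    rw [enat_eq_iff hr, enat_eq_iff hr, hlt r hrm, hlt (r - 1) (by omega)]
  refine ⟨fun j => ?_, fun j => ?_, fun r hr hrm => ?_⟩
  · rw [hlt m le_rfl, Finset.mem_filter]
    simp
  · rw [Ne, heq m h1 le_rfl]
    exact h3 j
  · obtain ⟨j, hj⟩ := hrep r hr hrm
    exact ⟨j, (heq r hr hrm.le j).2 hj⟩

end FailurePattern

/-! ### Uniformity of the sum of secrets -/

section Probability

variable {Ω α : Type*} [Finite Ω]

lemma prob_mono {E E' : Set Ω} (h : E ⊆ E') : prob E ≤ prob E' := by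
  unfold prob
  gcongr
  exact Nat.card_mono (Set.toFinite E') h

lemma prob_mem_eq_sum (g : Ω → α) (J : Finset α) :
    prob {ω | g ω ∈ J} = ∑ j ∈ J, prob {ω | g ω = j} := by
  have := Fintype.ofFinite Ω
  simp only [prob, ← Finset.sum_div]
  congr 1
  norm_cast
  simp only [Nat.card_eq_fintype_card, Set.coe_ofPred, Fintype.card_subtype]
  rw [Finset.card_eq_sum_card_fiberwise (f := g) (t := J) (fun ω hω => by simpa using hω)]
  refine Finset.sum_congr rfl fun j hj => ?_
  congr 1
  ext ω
  simp only [Finset.mem_filter, Finset.mem_univ, true_and, and_iff_right_iff_imp]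
  rintro rfl
  exact hj

/-- A random variable modulo `k` whose distribution is invariant under adding `1` is uniform. -/
lemma prob_eq_inv_of_shift [Nonempty Ω] {k : ℕ} [NeZero k] (g : Ω → ZMod k) (σ : Ω ≃ Ω)
    (hσ : ∀ ω, g (σ ω) = g ω + 1) (a : ZMod k) : prob {ω | g ω = a} = 1 / (k : ℝ) := by
  -- The bijection `σ` carries each fibre of `g` onto the next one, so all fibres have the same
  -- size.
  have hstep : ∀ b, Nat.card {ω // g ω = b} = Nat.card {ω // g ω = b + 1} := fun b =>
    Nat.card_congr (σ.subtypeEquiv fun ω => by rw [hσ, add_left_inj])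
  have hnat : ∀ s : ℕ, Nat.card {ω // g ω = (s : ZMod k)} = Nat.card {ω // g ω = 0} := by
    intro s
    induction s with
    | zero => rw [Nat.cast_zero]
    | succ s ih => rw [Nat.cast_succ, ← hstep, ih]
  have hall : ∀ b, Nat.card {ω // g ω = b} = Nat.card {ω // g ω = a} := by
    intro b
    rw [← ZMod.natCast_zmod_val b, ← ZMod.natCast_zmod_val a, hnat, hnat]
  have htot : Nat.card Ω = k * Nat.card {ω // g ω = a} := by
    rw [← Nat.card_congr (Equiv.sigmaFiberEquiv g), Nat.card_sigma]
    simp [hall, ZMod.card]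
  have hpos : 0 < Nat.card Ω := Nat.card_pos
  have hk : (k : ℝ) ≠ 0 := Nat.cast_ne_zero.2 (NeZero.ne k)
  have hc : (Nat.card {ω // g ω = a} : ℝ) ≠ 0 := by
    rw [htot] at hpos
    exact_mod_cast (Nat.pos_of_mul_pos_left hpos).ne'
  rw [prob, htot, Set.coe_ofPred]
  push_cast
  field_simp

end Probability

section Coins

variable {n f p : ℕ}

lemma Tape.secret_lt (τ : Tape n f p) (t : Fin (f + 1)) : τ.secret t < n - t := (τ.2.2.1 t).2

lemma Tape.degree_poly_le (τ : Tape n f p) (t : Fin (f + 1)) : (τ.poly t).degree ≤ 1 :=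
  degree_linear_le

lemma Tape.val_eval_poly [NeZero p] (hp : n ≤ p) (τ : Tape n f p) (t : Fin (f + 1)) :
    ((τ.poly t).eval 0).val = τ.secret t := by
  have := τ.secret_lt t
  rw [Tape.poly, eval_add, eval_mul, eval_X, mul_zero, zero_add, eval_C,
    ZMod.val_cast_of_lt (by omega)]

/-- Replace each secret `x` of an agent by `x + 1`, modulo the size of its range. -/
def Tape.rotate : Tape n f p ≃ Tape n f p :=
  (Equiv.refl _).prodCongr <| (Equiv.refl _).prodCongr <|
    (Equiv.piCongrRight fun _ => finRotate _).prodCongr (Equiv.refl _)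

lemma val_finRotate_modEq (k : ℕ) (x : Fin k) : (finRotate k x : ℕ) ≡ x + 1 [MOD k] := by
  cases k with
  | zero => exact x.elim0
  | succ k =>
    rw [finRotate_apply, Fin.val_add, Fin.val_one']
    exact (Nat.mod_modEq _ _).trans ((Nat.mod_modEq _ _).add_left _)

lemma Tape.secret_rotate (τ : Tape n f p) (t : Fin (f + 1)) :
    (τ.rotate.secret t : ZMod (n - t)) = τ.secret t + 1 := by
  have := (ZMod.natCast_eq_natCast_iff _ _ _).2 (val_finRotate_modEq (n - t) (τ.2.2.1 t))
  push_cast at this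
  exact this

/-- Rotating the secrets of a single member of `K` permutes the coin tosses and raises the sum by
`1` modulo `n - t`, whatever the other secrets are. -/
lemma prob_sum_secret [NeZero p] (hf : f + 1 < n) {K : Finset (Fin n)} (hK : K.Nonempty)
    (t : Fin (f + 1)) {s : ℕ} (hs : s < n - t) :
    prob {ω : Coins n f p | (∑ j ∈ K, (ω j).secret t) % (n - t) = s} = 1 / ((n - t : ℕ) : ℝ) := by
  obtain ⟨j₀, hj₀⟩ := hK
  have : NeZero (n - (t : ℕ)) := ⟨by omega⟩
  -- All ranges of secrets are nonempty, hence so is the space of coin tosses.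
  have : ∀ t : Fin (f + 1), NeZero (n - (t : ℕ)) := fun t => ⟨by omega⟩
  have : NeZero n := ⟨by omega⟩
  have hset : {ω : Coins n f p | (∑ j ∈ K, (ω j).secret t) % (n - t) = s} =
      {ω : Coins n f p | ((∑ j ∈ K, (ω j).secret t : ℕ) : ZMod (n - t)) = (s : ZMod (n - t))} := by
    ext ω
    rw [Set.mem_ofPred_eq, Set.mem_ofPred_eq, ZMod.natCast_eq_natCast_iff', Nat.mod_eq_of_lt hs]
  rw [hset]
  refine prob_eq_inv_of_shift (fun ω : Coins n f p => ((∑ j ∈ K, (ω j).secret t : ℕ) :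
    ZMod (n - t))) (Equiv.piCongrRight fun j => if j = j₀ then Tape.rotate else Equiv.refl _)
    (fun ω => ?_) _
  push_cast
  rw [← Finset.add_sum_erase _ _ hj₀, ← Finset.add_sum_erase _ _ hj₀,
    Finset.sum_congr rfl (g := fun j => ((ω j).secret t : ZMod (n - t)))]
  · simp only [Equiv.piCongrRight_apply, Pi.map_apply, if_true, Tape.secret_rotate]
    ring
  · intro j hj
    simp [Finset.ne_of_mem_erase hj]

end Coins

/-! ### Recovery of the secrets and the common dictator -/

section Final

variable {n f p : ℕ} {V : Type*} {pt : Fin n → ZMod p} {c : Scenario n f p V} {i j l : Fin n}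
  {m : ℕ}

lemma lt_time_iff {s : Status n} : (m : ℕ∞) < s.time ↔ ∀ m' ≤ m, ∀ k, s ≠ .crashed m' k := by
  rcases s with z | ⟨m', k⟩
  · simp [Status.time]
  · simp only [Status.time, Nat.cast_lt, ne_eq, Status.crashed.injEq, not_and]
    constructor
    · intro h b hb k' h'
      omega
    · intro h
      by_contra! hm
      exact h m' hm k rfl rfl

lemma mem_NC_iff (hF : c.F.faulty.card ≤ f) (hi : c.F.Survives i (f + 1)) :
    j ∈ NC i (exec pt (f + 1) c i) m ↔ (m : ℕ∞) < c.F.reportTime (f + 1) i j := by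
  rw [NC]
  split_ifs with hm
  · subst hm
    simpa using FailurePattern.reportTime_pos
  · rw [Finset.mem_filter, ← lt_time_iff, exec_status_time hF le_rfl hi]
    simp only [Finset.mem_univ, true_and, or_iff_right_iff_imp]
    rintro rfl
    rw [FailurePattern.reportTime_of_survives hi]
    exact ENat.natCast_lt_top m

/-- The sets `NC` decrease, so two consecutive ones agree exactly when no crash is charged to the
later round. -/
lemma mem_seemsClean_iff (hF : c.F.faulty.card ≤ f) (hi : c.F.Survives i (f + 1)) :
    m ∈ seemsClean i (exec pt (f + 1) c i) ↔
      1 ≤ m ∧ m ≤ f + 1 ∧ ∀ j, c.F.reportTime (f + 1) i j ≠ (m : ℕ∞) := by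
  rw [seemsClean, Set.mem_ofPred_eq, Finset.ext_iff]
  refine and_congr_right fun h1 => and_congr_right fun _ => forall_congr' fun j => ?_
  rw [mem_NC_iff hF hi, mem_NC_iff hF hi, Ne, FailurePattern.enat_eq_iff h1]
  have : (m : ℕ∞) < c.F.reportTime (f + 1) i j →
      ((m - 1 : ℕ) : ℕ∞) < c.F.reportTime (f + 1) i j :=
    fun h => lt_of_le_of_lt (by exact_mod_cast m.sub_le 1) h
  tauto

lemma knownShares_eq (hF : c.F.faulty.card ≤ f) (hi : c.F.Survives i (f + 1)) {y : Shares f p}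
    (h : knownShares pt i (c.ω i) (exec pt (f + 1) c i) j l = some y) :
    y = (c.ω j).sharesAt (pt l) := by
  rw [knownShares] at h
  split_ifs at h with hj hl
  · subst hj
    exact (Option.some.inj h).symm
  · subst hl
    rw [exec_held hF le_rfl hi] at h
    split_ifs at h
    exact (Option.some.inj h).symm
  · rw [exec_succ_revealed hF le_rfl hi] at h
    split_ifs at h with h1
    · rw [exec_held hF (by omega) h1.2.2.survives] at h
      split_ifs at h
      exact (Option.some.inj h).symm

/-- If every agent surviving round `f + 1` got the first message of `j`, then each of them knows at
least two shares of each secret of `j`. -/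
lemma exists_two_knownShares (hf : f + 1 < n) (hF : c.F.faulty.card ≤ f)
    (hi : c.F.Survives i (f + 1)) (hj : ∀ k, c.F.Survives k (f + 1) → c.F.Sends j 1 k) :
    ∃ l l', l ≠ l' ∧
      knownShares pt i (c.ω i) (exec pt (f + 1) c i) j l = some ((c.ω j).sharesAt (pt l)) ∧
      knownShares pt i (c.ω i) (exec pt (f + 1) c i) j l' = some ((c.ω j).sharesAt (pt l')) := by
  have hown : knownShares pt i (c.ω i) (exec pt (f + 1) c i) j i =
      some ((c.ω j).sharesAt (pt i)) := by
    rw [knownShares]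
    by_cases h : j = i
    · rw [if_pos h, h]
    · rw [if_neg h, if_pos rfl, exec_held hF le_rfl hi, if_pos (Or.inr ⟨by omega, hj i hi⟩)]
  -- For `f ≥ 1` any other correct agent has held its share since round `1`. For `f = 0` rounds `1`
  -- and `f + 1` coincide, nobody can relay a share of `j`, and the second share is the one `j`
  -- keeps for itself and reveals.
  obtain ⟨l, hli, hl⟩ : ∃ l, l ≠ i ∧ (j = i ∨ c.F.Correct l ∧ (j = l ∨ 1 ≤ f)) := by
    rcases Nat.eq_zero_or_pos f with rfl | hf0
    · by_cases h : j = i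
      · obtain ⟨l, hl, -⟩ := FailurePattern.exists_correct_ne hf hF i
        exact ⟨l, hl, Or.inl h⟩
      · refine ⟨j, h, Or.inr ⟨?_, Or.inl rfl⟩⟩
        have := Finset.card_eq_zero.1 (Nat.le_zero.1 hF)
        by_contra hc
        have hmem : j ∈ c.F.faulty := Finset.mem_filter.2 ⟨Finset.mem_univ j, hc⟩
        simp [this] at hmem
    · obtain ⟨l, hl, hc⟩ := FailurePattern.exists_correct_ne hf hF i
      exact ⟨l, hl, Or.inr ⟨hc, Or.inr hf0⟩⟩
  refine ⟨i, l, hli.symm, hown, ?_⟩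
  rw [knownShares]
  split_ifs with h
  · rw [h]
  · obtain ⟨hlc, hl⟩ := hl.resolve_left h
    rw [exec_succ_revealed hF le_rfl hi, if_pos ⟨rfl, ⟨hli, h⟩, (hlc.survives (f + 1)).sends⟩,
      exec_held hF (by omega) (hlc.survives f), if_pos]
    exact hl.imp id fun hf0 => ⟨hf0, hj l (hlc.survives _)⟩

/-- Crashing agents never send false shares, and two points determine a polynomial of degree at most
`1`. -/
lemma interpolates_iff [Fact p.Prime] (hpt : Function.Injective pt) (hf : f + 1 < n)
    (hF : c.F.faulty.card ≤ f) (hi : c.F.Survives i (f + 1))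
    (hj : ∀ k, c.F.Survives k (f + 1) → c.F.Sends j 1 k) (t : Fin (f + 1)) (q : (ZMod p)[X]) :
    Interpolates pt i (c.ω i) (exec pt (f + 1) c i) j t q ↔ q = (c.ω j).poly t := by
  constructor
  · rintro ⟨hq, h⟩
    obtain ⟨l, l', hne, hl, hl'⟩ := exists_two_knownShares (pt := pt) hf hF hi hj
    have hcard : ({pt l, pt l'} : Finset (ZMod p)).card = 2 :=
      Finset.card_pair (hpt.ne hne)
    have h12 : (1 : WithBot ℕ) < ((2 : ℕ) : WithBot ℕ) := by norm_num
    refine eq_of_degrees_lt_of_eval_finset_eq {pt l, pt l'} ?_ ?_ ?_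
    · rw [hcard]
      exact hq.trans_lt h12
    · rw [hcard]
      exact (Tape.degree_poly_le _ t).trans_lt h12
    · intro x hx
      rw [Finset.mem_insert, Finset.mem_singleton] at hx
      rcases hx with rfl | rfl
      exacts [h _ _ hl, h _ _ hl']
  · rintro rfl
    refine ⟨Tape.degree_poly_le _ t, fun l y hy => ?_⟩
    rw [knownShares_eq hF hi hy]
    rfl

lemma recoveredSecret_eq [Fact p.Prime] (hp : n ≤ p) {s : LocalState n f p V} {τ τ' : Tape n f p}
    {t : Fin (f + 1)} (h : ∀ q, Interpolates pt i τ s j t q ↔ q = τ'.poly t) :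
    recoveredSecret pt i τ s j t = τ'.secret t := by
  have hex : ∃! q, Interpolates pt i τ s j t q := ⟨τ'.poly t, (h _).2 rfl, fun q hq => (h q).1 hq⟩
  rw [recoveredSecret, dif_pos hex, (h _).1 hex.choose_spec.1, Tape.val_eval_poly hp]

lemma dictator_eq {s : LocalState n f p V} {τ : Tape n f p} {K : Finset (Fin n)}
    {x : Fin n → ℕ} (hm : IsLeast (seemsClean i s) m) (hK : NC i s m = K)
    (hx : ∀ j ∈ K, recoveredSecret pt i τ s j (Fin.ofNat (f + 1) (n - K.card)) = x j) :
    dictator pt i τ s =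
      (K.sort fun a b => b ≤ a)[(∑ j ∈ K, x j) % (n - (n - K.card))]? := by
  have hms : mStar i s = m := hm.csInf_eq
  simp only [dictator, hms, hK]
  rw [Finset.sum_congr rfl hx]

/-- Faulty agents that crash only after round `f + 1` decide too, so survival of that round is the
right condition for integrity and validity. -/
lemma exec_out (hF : c.F.faulty.card ≤ f) (m : ℕ) (i : Fin n) :
    (exec pt m c i).out = if m = f + 1 ∧ c.F.Survives i (f + 1) then
      some ((dictator pt i (c.ω i) (exec pt (f + 1) c i)).bind (exec pt (f + 1) c i).st)
      else none := by
  cases m with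
  | zero => rw [if_neg (by omega)]; rfl
  | succ m =>
    by_cases hs : c.F.Survives i (m + 1) ∧ m ≤ f
    · by_cases hmf : m = f
      · subst hmf
        rw [if_pos ⟨rfl, hs.1⟩, exec_succ hF le_rfl hs.1]
        dsimp only
        rw [if_neg (by omega)]
        rfl
      · rw [if_neg (by omega), exec_succ hF hs.2 hs.1]
        dsimp only
        rw [if_pos (by omega)]
        rfl
    · rw [exec]
      dsimp only
      rw [if_neg (fun h => hs ⟨h.1, by omega⟩), if_neg]
      rintro ⟨h1, h2⟩
      obtain rfl : m = f := by omega
      exact hs ⟨h2, le_rfl⟩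

/-- The agents surviving round `f + 1` agree on the first round that seems clean and on the
dictator, which is uniformly distributed over `NC` of that round. -/
theorem exists_common_dictator [Fact p.Prime] (hf : f + 1 < n) (hp : n ≤ p)
    (hpt : Function.Injective pt) {F : FailurePattern n} (hF : F.faulty.card ≤ f) (v : Fin n → V) :
    ∃ (m : ℕ) (K : Finset (Fin n)) (d : Coins n f p → Fin n),
      (∀ i, F.Survives i (f + 1) → i ∈ K) ∧ (∀ ω, d ω ∈ K) ∧
      (∀ j ∈ K, prob {ω | d ω = j} = 1 / (K.card : ℝ)) ∧
      ∀ ω i, F.Survives i (f + 1) →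
        IsLeast (seemsClean i (finalState pt F v ω i)) m ∧ NC i (finalState pt F v ω i) m = K ∧
        (∀ j ∈ K, ∀ t q, Interpolates pt i (ω i) (finalState pt F v ω i) j t q ↔
          q = (ω j).poly t) ∧
        dictator pt i (ω i) (finalState pt F v ω i) = some (d ω) ∧
        ∀ r, consOutcome pt F v ω i r = if r = f + 1 then some (some (v (d ω))) else none := by
  obtain ⟨m, K, hm1, hmf, hmK⟩ := FailurePattern.exists_first_clean hf hF
  have hKs : ∀ i, F.Survives i (f + 1) → i ∈ K := by
    intro i hi
    rw [(hmK i hi).1, FailurePattern.reportTime_of_survives hi]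
    exact ENat.natCast_lt_top m
  -- Missing the first message of `j` would give `j` the crash round `1 ≤ m` and exclude it from
  -- `K`.
  have hsends : ∀ j ∈ K, ∀ k, F.Survives k (f + 1) → F.Sends j 1 k := by
    intro j hj k hk
    by_contra hn
    rw [(hmK k hk).1, FailurePattern.reportTime_eq_one hn (by omega)] at hj
    have : m < 1 := by exact_mod_cast hj
    omega
  have hnK : n ≤ K.card + f :=
    FailurePattern.le_card_of_correct_mem hF fun i hi => hKs i (hi.survives _)
  have hKn : K.card ≤ n := by simpa using Finset.card_le_univ K
  set t : Fin (f + 1) := Fin.ofNat (f + 1) (n - K.card) with ht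
  -- As `n - |K| ≤ f`, the conversion to `Fin (f + 1)` does not wrap around.
  have htv : (t : ℕ) = n - K.card := Nat.mod_eq_of_lt (by omega)
  have hKt : n - (t : ℕ) = K.card := by omega
  set L := K.sort fun a b => b ≤ a with hL
  have hLlen : L.length = K.card := Finset.length_sort _
  have hlt : ∀ ω : Coins n f p, (∑ j ∈ K, (ω j).secret t) % (n - t) < L.length := fun ω => by
    rw [hLlen, ← hKt]
    exact Nat.mod_lt _ (by omega)
  refine ⟨m, K, fun ω => L[(∑ j ∈ K, (ω j).secret t) % (n - t)]'(hlt ω), hKs, fun ω => ?_,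
    fun j hj => ?_, fun ω i hi => ?_⟩
  · exact (Finset.mem_sort _).1 (List.getElem_mem _)
  · obtain ⟨s, hs, rfl⟩ := List.getElem_of_mem ((Finset.mem_sort fun a b => b ≤ a).2 hj)
    -- Since `L` lists `K` without repetition, `j` is the dictator exactly when the sum equals its
    -- position.
    have hnd : L.Nodup := Finset.sort_nodup _ _
    simp only [← hL, hnd.getElem_inj_iff]
    rw [prob_sum_secret hf ⟨_, hj⟩ t (by rwa [hKt, ← hLlen]), hKt]
  · have hleast : IsLeast (seemsClean i (finalState pt F v ω i)) m := by
      refine ⟨(mem_seemsClean_iff (c := ⟨F, v, ω⟩) hF hi).2 ⟨hm1, hmf, (hmK i hi).2.1⟩,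
        fun r hr => ?_⟩
      obtain ⟨hr1, -, hr⟩ := (mem_seemsClean_iff (c := ⟨F, v, ω⟩) hF hi).1 hr
      by_contra! hrm
      obtain ⟨j, hj⟩ := (hmK i hi).2.2 r hr1 hrm
      exact hr j hj
    have hNC : NC i (finalState pt F v ω i) m = K := by
      ext j
      rw [(hmK i hi).1]
      exact mem_NC_iff (c := ⟨F, v, ω⟩) hF hi
    have hint : ∀ j ∈ K, ∀ t q, Interpolates pt i (ω i) (finalState pt F v ω i) j t q ↔
        q = (ω j).poly t := fun j hj t q =>
      interpolates_iff (c := ⟨F, v, ω⟩) hpt hf hF hi (hsends j hj) t q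
    have hdict : dictator pt i (ω i) (finalState pt F v ω i) =
        some (L[(∑ j ∈ K, (ω j).secret t) % (n - t)]'(hlt ω)) := by
      rw [dictator_eq hleast hNC fun j hj => recoveredSecret_eq hp (hint j hj _), ← ht, ← htv,
        ← hL, List.getElem?_eq_getElem (hlt ω)]
    refine ⟨hleast, hNC, hint, hdict, fun r => ?_⟩
    have hout := exec_out (pt := pt) (c := ⟨F, v, ω⟩) hF r i
    rw [consOutcome, hout]
    simp only [hi, and_true]
    congr 2
    have hd := hdict
    rw [finalState] at hd
    rw [hd, Option.bind_some, exec_st (c := ⟨F, v, ω⟩) hF le_rfl hi, if_pos]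
    exact Or.inr ⟨by omega, hsends _ ((Finset.mem_sort _).1 (List.getElem_mem _)) i hi⟩

lemma consOutcome_of_not_survives {F : FailurePattern n} (hF : F.faulty.card ≤ f) (v : Fin n → V)
    (ω : Coins n f p) (hi : ¬ F.Survives i (f + 1)) (r : ℕ) : consOutcome pt F v ω i r = none := by
  rw [consOutcome, exec_out (c := ⟨F, v, ω⟩) hF, if_neg (fun h => hi h.2)]

end Final

end

end FairConsensus

open FairConsensus in
theorem mainTheorem2 {V : Type*} (n f p : ℕ) [Fact p.Prime] (hf : f + 1 < n) (hp : n ≤ p)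
    (pt : Fin n → ZMod p) (hpt : Function.Injective pt) :
    SolvesFairConsensus (V := V) f
      (fun F v (ω : Coins n f p) => consOutcome pt F v ω) ∧
    ∀ F : FailurePattern n, F.faulty.card ≤ f → ∀ v : Fin n → V,
      ∃ (m : ℕ) (K : Finset (Fin n)),
        (∀ i, F.Correct i → i ∈ K) ∧
        (∀ (ω : Coins n f p) (i : Fin n), F.Correct i →
          IsLeast (seemsClean i (finalState pt F v ω i)) m ∧
          NC i (finalState pt F v ω i) m = K ∧
          (∀ j ∈ K, ∀ (t : Fin (f + 1)) (q : Polynomial (ZMod p)),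
            Interpolates pt i (ω i) (finalState pt F v ω i) j t q ↔ q = (ω j).poly t)) ∧
        (∀ ω : Coins n f p, ∃ j ∈ K, IsConsensus F (consOutcome pt F v ω) (v j) ∧
          ∀ i, F.Correct i → dictator pt i (ω i) (finalState pt F v ω i) = some j) ∧
        (∀ j ∈ K,
          prob {ω : Coins n f p | ∀ i, F.Correct i →
            dictator pt i (ω i) (finalState pt F v ω i) = some j} = 1 / (K.card : ℝ) ∧
          (1 : ℝ) / n ≤ 1 / (K.card : ℝ)) := by
  have hinv : ∀ {K : Finset (Fin n)} {j : Fin n}, j ∈ K → (1 : ℝ) / n ≤ 1 / (K.card : ℝ) := by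
    intro K j hj
    have h1 : (0 : ℝ) < K.card := by exact_mod_cast Finset.card_pos.2 ⟨j, hj⟩
    have h2 : (K.card : ℝ) ≤ n := by exact_mod_cast (by simpa using Finset.card_le_univ K)
    exact one_div_le_one_div_of_le h1 h2
  refine ⟨fun F hF v => ?_, fun F hF v => ?_⟩ <;>
    obtain ⟨m, K, d, hKs, hdK, hprob, hrun⟩ := exists_common_dictator hf hp hpt hF v
  · have hcons : ∀ ω i r e, consOutcome pt F v ω i r = some e →
        r = f + 1 ∧ e = some (v (d ω)) := by
      intro ω i r e h
      by_cases hi : F.Survives i (f + 1)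
      · rw [(hrun ω i hi).2.2.2.2] at h
        split_ifs at h with hr
        exact ⟨hr, (Option.some.inj h).symm⟩
      · rw [consOutcome_of_not_survives hF v ω hi] at h
        cases h
    have hdec : ∀ ω i, F.Correct i →
        consOutcome pt F v ω i (f + 1) = some (some (v (d ω))) := by
      intro ω i hi
      rw [(hrun ω i (hi.survives _)).2.2.2.2, if_pos rfl]
    refine ⟨fun ω => ⟨?_, ?_, ?_, ?_⟩, fun u => ?_⟩
    · intro i j _ _ r r' e e' h h'
      rw [(hcons ω i r e h).2, (hcons ω j r' e' h').2]
    · exact fun i hi => ⟨f + 1, _, hdec ω i hi⟩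
    · intro i r r' e e' h h'
      rw [(hcons ω i r e h).1, (hcons ω i r' e' h').1]
    · exact fun i r e h => ⟨d ω, (hcons ω i r e h).2⟩
    · classical
      set J := Finset.univ.filter fun i => F.Correct i ∧ v i = u
      have hJ : ∀ {j}, j ∈ J → F.Correct j ∧ v j = u := fun h => (Finset.mem_filter.1 h).2
      -- It suffices that the dictator be one of the correct agents with preference `u`, each of
      -- which is chosen with probability at least `1 / n`.
      calc (J.card : ℝ) / n = ∑ _j ∈ J, (1 : ℝ) / n := by
            rw [Finset.sum_const, nsmul_eq_mul, mul_one_div]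
        _ ≤ ∑ j ∈ J, prob {ω | d ω = j} := by
            refine Finset.sum_le_sum fun j hj => ?_
            have hjK := hKs j ((hJ hj).1.survives _)
            rw [hprob j hjK]
            exact hinv hjK
        _ = prob {ω | d ω ∈ J} := (prob_mem_eq_sum d J).symm
        _ ≤ prob {ω | IsConsensus F (consOutcome pt F v ω) u} :=
          prob_mono fun ω hω i hi => ⟨f + 1, by rw [hdec ω i hi, (hJ hω).2]⟩
  · refine ⟨m, K, fun i hi => hKs i (hi.survives _), fun ω i hi => ?_, fun ω => ?_,
      fun j hj => ⟨?_, hinv hj⟩⟩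
    · obtain ⟨h1, h2, h3, -⟩ := hrun ω i (hi.survives _)
      exact ⟨h1, h2, h3⟩
    · refine ⟨d ω, hdK ω, fun i hi => ⟨f + 1, ?_⟩, fun i hi => (hrun ω i (hi.survives _)).2.2.2.1⟩
      rw [(hrun ω i (hi.survives _)).2.2.2.2, if_pos rfl]
    · rw [← hprob j hj]
      congr 1
      ext ω
      -- Some agent is correct, so the event is not vacuous and pins down `d ω`.
      obtain ⟨i₀, -, hi₀⟩ := FailurePattern.exists_correct_ne hf hF ⟨0, by omega⟩
      constructor
      · intro h
        have := h i₀ hi₀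
        rw [(hrun ω i₀ (hi₀.survives _)).2.2.2.1] at this
        exact Option.some.inj this
      · rintro rfl i hi
        exact (hrun ω i (hi.survives _)).2.2.2.1
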